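/- Fix a lattice step $\varepsilon>0$ and a mass $m>0$. A \emph{checker path} is a finite sequence of points of the lattice $\varepsilon\mathbb{Z}^2$ such that the vector from each point (except the last one) to the next one equals either $(\varepsilon,\varepsilon)$ or $(-\varepsilon,\varepsilon)$. For a checker path $s$, let $\mathrm{turns}(s)$ be the number of points of $s$ (not the first and not the last one) such that the vectors from the point to the next and to the previous points of $s$ are orthogonal. For $(x,t)\in\varepsilon\mathbb{Z}^2$ with $t>0$ put $$a(x,t,m,\varepsilon):=(1+m^2\varepsilon^2)^{(1-t/\varepsilon)/2}\; i\,\sum_{s}(-im\varepsilon)^{\mathrm{turns}(s)},\qquad P(x,t,m,\varepsilon):=|a(x,t,m,\varepsilon)|^2,$$ where the sum is over all checker paths $s$ from $(0,0)$ to $(x,t)$ with the first step to $(\varepsilon,\varepsilon)$. \textbf{Corollary (Large-time limiting distribution).} For each $m>0$ and each $\varepsilon>0$ with $\varepsilon\le 1/m$, $$\sum_{\substack{x\in\varepsilon\mathbb{Z}\\ x\le vt}}P(x,t,m,\varepsilon)\;\longrightarrow\;F(v,m,\varepsilon):=\begin{cases}0,&\text{if } v\le -\frac{1}{\sqrt{1+m^2\varepsilon^2}};\\[2pt]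 \dfrac1\pi\arccos\dfrac{1-(1+m^2\varepsilon^2)v}{\sqrt{1+m^2\varepsilon^2}\,(1-v)},&\text{if } |v|<\frac{1}{\sqrt{1+m^2\varepsilon^2}};\\[2pt] 1,&\text{if } v\ge \frac{1}{\sqrt{1+m^2\varepsilon^2}}\end{cases}$$ as $t\to\infty$, $t\in\varepsilon\mathbb{Z}$, uniformly in $v\in\mathbb{R}$. -/

import Mathlib

open Filter

noncomputable section

namespace FeynmanCheckers

/-- The one-dimensional lattice `εℤ`. -/
def lattice (ε : ℝ) : Set ℝ := {x | ∃ k : ℤ, x = k * ε}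

/-- The vector from `p` to `q` equals either `(ε, ε)` or `(-ε, ε)`. -/
def IsStep (ε : ℝ) (p q : ℝ × ℝ) : Prop := q - p = (ε, ε) ∨ q - p = (-ε, ε)

/-- A checker path: a finite sequence of points `(x, t)` of the lattice `εℤ × εℤ` such that the
vector from each point (except the last one) to the next one is `(ε, ε)` or `(-ε, ε)`. -/
structure IsCheckerPath (ε : ℝ) (s : List (ℝ × ℝ)) : Prop where
  mem_lattice : ∀ p ∈ s, p.1 ∈ lattice ε ∧ p.2 ∈ lattice ε
  steps : s.IsChain (IsStep ε)

/-- The vectors from `q` to `r` and from `q` to `p` are orthogonal. -/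
def IsTurn (p q r : ℝ × ℝ) : Prop :=
  (r.1 - q.1) * (p.1 - q.1) + (r.2 - q.2) * (p.2 - q.2) = 0

open Classical in
/-- The number of points of the sequence, not the first and not the last one, such that the
vectors from the point to the next and to the previous ones are orthogonal. -/
def turns : List (ℝ × ℝ) → ℕ
  | p :: q :: r :: s => (if IsTurn p q r then 1 else 0) + turns (q :: r :: s)
  | _ => 0

/-- The checker paths from `(0, 0)` to `(x, t)` with the first step to `(ε, ε)`. -/
def paths (x t ε : ℝ) : Set (List (ℝ × ℝ)) :=
  {s | IsCheckerPath ε s ∧ s[0]? = some (0, 0) ∧ s[1]? = some (ε, ε) ∧ s.getLast? = some (x, t)}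

/-- The amplitude `a(x, t, m, ε)`. The sum is over a finite set of paths when `ε > 0`,
see `paths_finite` below. -/
def a (x t m ε : ℝ) : ℂ :=
  (((1 + m ^ 2 * ε ^ 2) ^ ((1 - t / ε) / 2) : ℝ) : ℂ) * Complex.I *
    ∑ᶠ s ∈ paths x t ε, (-Complex.I * (m : ℂ) * (ε : ℂ)) ^ turns s

/-- The probability `P(x, t, m, ε)` to find the electron at `(x, t)`. -/
def P (x t m ε : ℝ) : ℝ := ‖a x t m ε‖ ^ 2

/-- The distribution function: the sum of `P(x, t, m, ε)` over all `x ∈ εℤ` with `x ≤ vt`. Only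
finitely many terms are nonzero when `ε > 0`, see `P_finite_support` below. -/
def distrib (v t m ε : ℝ) : ℝ :=
  ∑' x : {x : ℝ // x ∈ lattice ε ∧ x ≤ v * t}, P x t m ε

/-- The limiting distribution function `F(v, m, ε)`. -/
def F (v m ε : ℝ) : ℝ :=
  if v ≤ -(1 / √(1 + m ^ 2 * ε ^ 2)) then 0
  else if v < 1 / √(1 + m ^ 2 * ε ^ 2) then
    1 / Real.pi * Real.arccos
      ((1 - (1 + m ^ 2 * ε ^ 2) * v) / (√(1 + m ^ 2 * ε ^ 2) * (1 - v)))
  else 1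

/-- Along a path, time grows by `ε` and the position changes by at most `ε` at each step. -/
lemma chain_bounds {ε : ℝ} (hε : 0 < ε) :
    ∀ (s : List (ℝ × ℝ)) (p l : ℝ × ℝ), (p :: s).IsChain (IsStep ε) →
      (p :: s).getLast? = some l → l.2 - p.2 = s.length * ε ∧ |l.1 - p.1| ≤ l.2 - p.2
  | [], p, l, _, hl => by
    simp at hl
    subst hl
    simp
  | q :: s, p, l, hc, hl => by
    rw [List.isChain_cons_cons] at hc
    have hl' : (q :: s).getLast? = some l := by simpa using hl
    obtain ⟨h1, h2⟩ := chain_bounds hε s q l hc.2 hl'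
    rw [abs_le] at h2 ⊢
    push_cast [List.length_cons]
    rcases hc.1 with h | h <;> simp only [Prod.ext_iff, Prod.fst_sub, Prod.snd_sub] at h <;>
      refine ⟨by linarith [h.2], by linarith [h.1, h.2], by linarith [h.1, h.2]⟩

/-- There are finitely many sequences of given length with a given first point. -/
lemma chains_finite (ε : ℝ) : ∀ (n : ℕ) (p : ℝ × ℝ),
    {s : List (ℝ × ℝ) | s.length = n ∧ (p :: s).IsChain (IsStep ε)}.Finite
  | 0, p => (Set.finite_singleton []).subset fun s hs => by
    simpa using List.length_eq_zero_iff.1 hs.1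
  | n + 1, p => by
    refine (((chains_finite ε n (p + (ε, ε))).image (List.cons (p + (ε, ε)))).union
      ((chains_finite ε n (p + (-ε, ε))).image (List.cons (p + (-ε, ε))))).subset ?_
    rintro (_ | ⟨q, s⟩) ⟨hn, hc⟩
    · simp at hn
    · rw [List.isChain_cons_cons] at hc
      have hn' : s.length = n := by simpa using hn
      rcases hc.1 with h | h
      · obtain rfl : q = p + (ε, ε) := by rw [← h]; abel
        exact Or.inl ⟨s, ⟨hn', hc.2⟩, rfl⟩
      · obtain rfl : q = p + (-ε, ε) := by rw [← h]; abel
        exact Or.inr ⟨s, ⟨hn', hc.2⟩, rfl⟩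

lemma paths_finite {ε : ℝ} (hε : 0 < ε) (x t : ℝ) : (paths x t ε).Finite := by
  refine ((chains_finite ε ⌊t / ε⌋₊ (0, 0)).image (List.cons (0, 0))).subset ?_
  rintro (_ | ⟨p, s⟩) ⟨hp, h0, -, hl⟩
  · simp at h0
  · obtain rfl : p = (0, 0) := by simpa using h0
    refine ⟨s, ⟨?_, hp.steps⟩, rfl⟩
    have h := (chain_bounds hε s _ _ hp.steps hl).1
    simp only [sub_zero] at h
    rw [h, mul_div_cancel_right₀ _ hε.ne', Nat.floor_natCast]

lemma P_finite_support {ε : ℝ} (hε : 0 < ε) (t m : ℝ) :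
    {x : ℝ | x ∈ lattice ε ∧ P x t m ε ≠ 0}.Finite := by
  refine ((Set.finite_Icc (-⌈t / ε⌉) ⌈t / ε⌉).image fun k : ℤ => (k : ℝ) * ε).subset ?_
  rintro _ ⟨⟨k, rfl⟩, hP⟩
  refine ⟨k, ?_, rfl⟩
  obtain ⟨s, hs⟩ : (paths (k * ε) t ε).Nonempty := by
    by_contra h
    rw [Set.not_nonempty_iff_eq_empty] at h
    simp [P, a, h] at hP
  obtain ⟨hp, h0, -, hl⟩ := hs
  obtain _ | ⟨p, s⟩ := s
  · simp at h0
  · obtain rfl : p = (0, 0) := by simpa using h0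
    have h := (chain_bounds hε s _ _ hp.steps hl).2
    simp only [sub_zero] at h
    have h2 : |(k : ℝ)| ≤ t / ε := by
      rw [abs_mul, abs_of_pos hε] at h
      exact (le_div_iff₀ hε).2 h
    have h3 := abs_le.1 (h2.trans (Int.le_ceil _))
    exact ⟨by exact_mod_cast h3.1, by exact_mod_cast h3.2⟩

end FeynmanCheckers

end

open Filter

noncomputable section

namespace FeynmanCheckers

open Topology MeasureTheory ComplexConjugate ProbabilityTheory

/-! The Fourier transform in position diagonalizes the walk. With `μ = mε`, the path sums satisfy a
linear recursion in the number of steps. After normalization its Fourier transform has a closed form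
with phases `n * freq μ k`, where `cos (freq μ k) = hop μ * cos k` (`hasSum_fourier_pathSum`).
Parseval's identity then writes the characteristic function of the position as an integral of
`charKernel` over one period (`sum_prob_mul_exp`).

At frequency `ξ / (n + 1)`, the two phases in the kernel differ by nearly `ξ * vel μ k`, where `vel`
is the derivative of `freq`. Dominated convergence therefore gives the integral of `limKernel`. Up
to an odd part, that integrand is `(1 + vel μ k) * exp (i ξ vel μ k)`, and `1 + vel μ k` is the
Jacobian of `θ = k + freq μ k`. In the variable `θ` the velocity is a Möbius function of `cos θ`
(`angleVel_add_freq`, `integral_limKernel`). So the limit law is that of `angleVel μ θ` with `θ`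
uniform on `[0, π]`, which explains the arccosine in `F` (`cdf_limLaw`).

Lévy's continuity theorem gives weak convergence. The limit has no atoms, so Pólya's theorem makes
the convergence of distribution functions uniform (`tendstoUniformly_cdf`). -/

/-! ### Path sums and their recursion. -/

/-- The horizontal displacement of a step: `1` to the right (`true`), `-1` to the left (`false`). -/
def sgn (d : Bool) : ℤ := if d then 1 else -1

/-- The sum of `(-iμ) ^ turns` over the paths on `ℤ²` of `n + 1` steps, the first of them in
direction `d`, with total horizontal displacement `j`. -/
def pathSum (μ : ℝ) : ℕ → Bool → ℤ → ℂ
  | 0, d, j => if j = sgn d then 1 else 0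
  | n + 1, d, j =>
    pathSum μ n d (j - sgn d) + -Complex.I * μ * pathSum μ n (!d) (j - sgn d)

/-- The step in direction `d`. -/
def stepVec (ε : ℝ) (d : Bool) : ℝ × ℝ := (sgn d * ε, ε)

/-- The continuations by `n` points of a path that has come to `q`, ending at `l`. -/
def continuations (ε : ℝ) (n : ℕ) (q l : ℝ × ℝ) : Set (List (ℝ × ℝ)) :=
  {s | s.length = n ∧ (q :: s).IsChain (IsStep ε) ∧ (q :: s).getLast? = some l}

lemma isStep_iff {ε : ℝ} {p q : ℝ × ℝ} : IsStep ε p q ↔ ∃ d, q = p + stepVec ε d := by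
  simp only [IsStep, Bool.exists_bool, stepVec, sgn, sub_eq_iff_eq_add']
  simp [or_comm]

lemma isTurn_stepVec {ε : ℝ} (hε : 0 < ε) (p : ℝ × ℝ) (d e : Bool) :
    IsTurn p (p + stepVec ε d) (p + stepVec ε d + stepVec ε e) ↔ e ≠ d := by
  have h : ε * ε ≠ 0 := (mul_pos hε hε).ne'
  cases d <;> cases e <;> simp [IsTurn, stepVec, sgn, hε.ne']

lemma continuations_finite (ε : ℝ) (n : ℕ) (q l : ℝ × ℝ) : (continuations ε n q l).Finite :=
  (chains_finite ε n q).subset fun _ hs => ⟨hs.1, hs.2.1⟩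

lemma continuations_succ (ε : ℝ) (n : ℕ) (q l : ℝ × ℝ) :
    continuations ε (n + 1) q l = ⋃ d : Bool,
      List.cons (q + stepVec ε d) '' continuations ε n (q + stepVec ε d) l := by
  ext s
  simp only [Set.mem_iUnion, Set.mem_image, continuations, Set.mem_ofPred_eq]
  constructor
  · rintro ⟨h1, h2, h3⟩
    obtain _ | ⟨r, s⟩ := s
    · simp at h1
    · rw [List.isChain_cons_cons, isStep_iff] at h2
      obtain ⟨⟨d, rfl⟩, h2⟩ := h2
      exact ⟨d, s, ⟨by simpa using h1, h2, by simpa using h3⟩, rfl⟩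
  · rintro ⟨d, s, ⟨h1, h2, h3⟩, rfl⟩
    exact ⟨by simpa using h1, List.isChain_cons_cons.2 ⟨isStep_iff.2 ⟨d, rfl⟩, h2⟩,
      by simpa using h3⟩

/-- Induction by splitting on the second step: it contributes a factor `-iμ` exactly when it changes
direction. The starting point `p` stays in the list because the turn at the next point depends on
it. -/
lemma finsum_continuations {ε : ℝ} (hε : 0 < ε) (μ : ℝ) (n : ℕ) :
    ∀ (p : ℝ × ℝ) (d : Bool) (j : ℤ),
    ∑ᶠ s ∈ continuations ε n (p + stepVec ε d) (p + (j * ε, (n + 1) * ε)),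
      (-Complex.I * (μ : ℂ)) ^ turns (p :: (p + stepVec ε d) :: s) = pathSum μ n d j := by
  induction n with
  | zero =>
    intro p d j
    have h : continuations ε 0 (p + stepVec ε d) (p + (j * ε, ((0 : ℕ) + 1) * ε))
        = if j = sgn d then {[]} else ∅ := by
      ext s
      simp only [continuations, Set.mem_ofPred_eq, List.length_eq_zero_iff]
      constructor
      · rintro ⟨rfl, -, h⟩
        simp [stepVec, hε.ne'] at h
        simp [h]
      · split_ifs with hj
        · rintro rfl
          simp [stepVec, hj]
        · simp
    rw [h]
    split_ifs with hj <;> simp [pathSum, hj, turns]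
  | succ n ih =>
    intro p d j
    set q := p + stepVec ε d with hq
    have hl : p + (j * ε, ((n + 1 : ℕ) + 1) * ε)
        = q + (((j - sgn d : ℤ) : ℝ) * ε, ((n : ℝ) + 1) * ε) := by
      rw [hq, stepVec, add_assoc]
      congr 1
      ext <;> simp <;> ring
    rw [hl, continuations_succ, finsum_mem_iUnion
      (f := fun s => (-Complex.I * (μ : ℂ)) ^ turns (p :: q :: s))]
    · have key : ∀ e : Bool, ∑ᶠ s ∈ List.cons (q + stepVec ε e) '' continuations ε n
          (q + stepVec ε e) (q + (((j - sgn d : ℤ) : ℝ) * ε, ((n : ℝ) + 1) * ε)),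
          (-Complex.I * (μ : ℂ)) ^ turns (p :: q :: s)
          = (if e ≠ d then -Complex.I * (μ : ℂ) else 1) * pathSum μ n e (j - sgn d) := by
        intro e
        rw [finsum_mem_image List.cons_injective.injOn, ← ih q e, mul_finsum_mem]
        refine finsum_mem_congr rfl fun s _ => ?_
        rw [turns, pow_add, hq]
        simp only [isTurn_stepVec hε]
        split_ifs <;> simp
      rw [finsum_eq_sum_of_fintype, Fintype.sum_bool, key, key]
      cases d <;> simp [pathSum, add_comm]
    · intro d e hde
      rw [Function.onFun, Set.disjoint_left]
      rintro _ ⟨s, -, rfl⟩ ⟨s', -, h⟩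
      simp only [List.cons.injEq, add_right_inj, stepVec, Prod.mk.injEq, and_true,
        mul_eq_mul_right_iff, hε.ne', or_false] at h
      revert hde h
      cases d <;> cases e <;> norm_num [sgn]
    · exact fun e => (continuations_finite _ _ _ _).image _

lemma mem_lattice_of_isChain {ε : ℝ} : ∀ (s : List (ℝ × ℝ)) (p : ℝ × ℝ),
    (p :: s).IsChain (IsStep ε) → p.1 ∈ lattice ε ∧ p.2 ∈ lattice ε →
      ∀ q ∈ p :: s, q.1 ∈ lattice ε ∧ q.2 ∈ lattice ε
  | [], p, _, hp => by simpa using hp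
  | r :: s, p, hc, hp => by
    rw [List.isChain_cons_cons, isStep_iff] at hc
    obtain ⟨⟨d, rfl⟩, hc⟩ := hc
    have hr := mem_lattice_of_isChain s _ hc (by
      obtain ⟨⟨i, hi⟩, ⟨j, hj⟩⟩ := hp
      exact ⟨⟨i + sgn d, by simp [stepVec, hi]; ring⟩, ⟨j + 1, by simp [stepVec, hj]; ring⟩⟩)
    intro q hq
    rcases List.mem_cons.1 hq with rfl | hq
    · exact hp
    · exact hr q hq

lemma paths_eq_image {ε : ℝ} (hε : 0 < ε) (n : ℕ) (j : ℤ) :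
    paths (j * ε) ((n + 1) * ε) ε = (fun s => (0 : ℝ × ℝ) :: (0 + stepVec ε true) :: s) ''
      continuations ε n (0 + stepVec ε true) (0 + (j * ε, (n + 1) * ε)) := by
  have hv : (0 : ℝ × ℝ) + stepVec ε true = (ε, ε) := by simp [stepVec, sgn]
  ext s
  simp only [hv, paths, continuations, Set.mem_ofPred_eq, Set.mem_image, zero_add]
  constructor
  · rintro ⟨hp, h0, h1, hl⟩
    obtain _ | ⟨p, _ | ⟨q, s⟩⟩ := s
    · simp at h0
    · simp at h1
    · obtain rfl : p = (0, 0) := by simpa using h0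
      obtain rfl : q = (ε, ε) := by simpa using h1
      refine ⟨s, ⟨?_, (List.isChain_cons_cons.1 hp.steps).2, by simpa using hl⟩, rfl⟩
      have h := (chain_bounds hε _ _ _ hp.steps hl).1
      simp only [sub_zero, List.length_cons] at h
      have h' := mul_right_cancel₀ hε.ne' h
      exact_mod_cast (add_right_cancel (by exact_mod_cast h' : n + 1 = s.length + 1)).symm
  · rintro ⟨s, ⟨-, hc, hl⟩, rfl⟩
    have hc' : ((0 : ℝ × ℝ) :: (ε, ε) :: s).IsChain (IsStep ε) :=
      List.isChain_cons_cons.2 ⟨Or.inl (by simp), hc⟩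
    exact ⟨⟨mem_lattice_of_isChain _ _ hc' ⟨⟨0, by simp⟩, ⟨0, by simp⟩⟩, hc'⟩, rfl, rfl,
      by simpa using hl⟩

/-- At `t = (n + 1) * ε` the exponent in the normalization is `-n / 2`: the first step is free, and
each later one costs a factor `hop`, which is squared here. -/
lemma P_eq {ε : ℝ} (hε : 0 < ε) (m : ℝ) (n : ℕ) (j : ℤ) :
    P (j * ε) ((n + 1) * ε) m ε
      = (1 / √(1 + (m * ε) ^ 2)) ^ (2 * n) * ‖pathSum (m * ε) n true j‖ ^ 2 := by
  have h0 : (0 : ℝ) < 1 + (m * ε) ^ 2 := by positivity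
  rw [P, a, paths_eq_image hε, finsum_mem_image
    (fun _ _ _ _ h => by simpa using h), ← finsum_continuations hε _ n 0 true j, norm_mul, norm_mul,
    Complex.norm_I, mul_one, mul_pow, ← mul_pow m, mul_div_cancel_right₀ _ hε.ne']
  congr 1
  · rw [Complex.norm_real, Real.norm_eq_abs, sq_abs, pow_mul, one_div, inv_pow, Real.sq_sqrt h0.le,
      ← Real.rpow_mul_natCast h0.le, inv_pow, ← Real.rpow_natCast _ n, ← Real.rpow_neg h0.le]
    congr 1
    push_cast
    ring
  · push_cast
    simp only [mul_assoc]

lemma pathSum_eq_zero (μ : ℝ) (n : ℕ) : ∀ (d : Bool) (j : ℤ),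
    j ∉ Finset.Icc (-(n + 1 : ℤ)) (n + 1) → pathSum μ n d j = 0 := by
  induction n with
  | zero =>
    intro d j hj
    rw [pathSum, if_neg]
    rintro rfl
    revert hj
    cases d <;> decide
  | succ n ih =>
    intro d j hj
    have h : j - sgn d ∉ Finset.Icc (-(n + 1 : ℤ)) (n + 1) := by
      contrapose! hj
      simp only [Finset.mem_Icc] at hj ⊢
      cases d <;> simp [sgn] at hj ⊢ <;> omega
    rw [pathSum, ih _ _ h, ih _ _ h]
    simp

lemma pathSum_succ_re (μ : ℝ) (n : ℕ) (d : Bool) (j : ℤ) : (pathSum μ (n + 1) d j).re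
    = (pathSum μ n d (j - sgn d)).re + μ * (pathSum μ n (!d) (j - sgn d)).im := by
  simp [pathSum]

lemma pathSum_succ_im (μ : ℝ) (n : ℕ) (d : Bool) (j : ℤ) : (pathSum μ (n + 1) d j).im
    = (pathSum μ n d (j - sgn d)).im - μ * (pathSum μ n (!d) (j - sgn d)).re := by
  simp [pathSum, sub_eq_add_neg]

/-! ### Dispersion relation and group velocity. -/

/-- The normalizing factor per step. -/
def hop (μ : ℝ) : ℝ := 1 / √(1 + μ ^ 2)

lemma hop_pos (μ : ℝ) : 0 < hop μ := by
  unfold hop; positivity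

lemma hop_sq (μ : ℝ) : hop μ ^ 2 * (1 + μ ^ 2) = 1 := by
  have h : (0 : ℝ) < 1 + μ ^ 2 := by positivity
  rw [hop, div_pow, Real.sq_sqrt h.le]
  field_simp

lemma hop_lt_one {μ : ℝ} (hμ : 0 < μ) : hop μ < 1 := by
  nlinarith [hop_sq μ, hop_pos μ, mul_pos (pow_pos (hop_pos μ) 2) (pow_pos hμ 2)]

/-- The dispersion relation: the frequency as a function of the wave number. -/
def freq (μ k : ℝ) : ℝ := Real.arccos (hop μ * Real.cos k)

/-- The group velocity. -/
def vel (μ k : ℝ) : ℝ := hop μ * Real.sin k / Real.sin (freq μ k)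

/-- The weight complementary to the group velocity, see `vel_sq_add_cov_sq`. -/
def cov (μ k : ℝ) : ℝ := hop μ * μ / Real.sin (freq μ k)

/-- Strictness, due to positive mass, keeps `freq` away from the endpoints of `arccos`, so it is
differentiable and its sine does not vanish. -/
lemma abs_hop_mul_cos_lt {μ : ℝ} (hμ : 0 < μ) (k : ℝ) : |hop μ * Real.cos k| < 1 := by
  rw [abs_mul, abs_of_pos (hop_pos μ)]
  nlinarith [hop_lt_one hμ, hop_pos μ, Real.abs_cos_le_one k, abs_nonneg (Real.cos k)]

lemma cos_freq {μ : ℝ} (hμ : 0 < μ) (k : ℝ) : Real.cos (freq μ k) = hop μ * Real.cos k :=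
  have h := abs_lt.1 (abs_hop_mul_cos_lt hμ k)
  Real.cos_arccos h.1.le h.2.le

lemma sin_freq_pos {μ : ℝ} (hμ : 0 < μ) (k : ℝ) : 0 < Real.sin (freq μ k) := by
  have h := (sq_lt_one_iff_abs_lt_one _).2 (abs_hop_mul_cos_lt hμ k)
  rw [freq, Real.sin_arccos]
  exact Real.sqrt_pos.2 (by linarith)

lemma sin_freq_sq {μ : ℝ} (hμ : 0 < μ) (k : ℝ) :
    Real.sin (freq μ k) ^ 2 = hop μ ^ 2 * (μ ^ 2 + Real.sin k ^ 2) := by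
  rw [Real.sin_sq, cos_freq hμ, Real.sin_sq]
  linear_combination -hop_sq μ

lemma vel_sq_add_cov_sq {μ : ℝ} (hμ : 0 < μ) (k : ℝ) : vel μ k ^ 2 + cov μ k ^ 2 = 1 := by
  have h := sin_freq_pos hμ k
  rw [vel, cov]
  field_simp
  rw [sin_freq_sq hμ]
  ring

lemma hasDerivAt_freq {μ : ℝ} (hμ : 0 < μ) (k : ℝ) : HasDerivAt (freq μ) (vel μ k) k := by
  have h := abs_lt.1 (abs_hop_mul_cos_lt hμ k)
  have h1 := (Real.hasDerivAt_arccos h.1.ne' h.2.ne).comp k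
    ((Real.hasDerivAt_cos k).const_mul (hop μ))
  refine h1.congr_deriv ?_
  rw [vel, freq, Real.sin_arccos]
  ring

lemma continuous_freq (μ : ℝ) : Continuous (freq μ) := by
  unfold freq; fun_prop

lemma continuous_vel {μ : ℝ} (hμ : 0 < μ) : Continuous (vel μ) :=
  (by fun_prop : Continuous fun k => hop μ * Real.sin k).div
    (Real.continuous_sin.comp (continuous_freq μ)) fun k => (sin_freq_pos hμ k).ne'

lemma continuous_cov {μ : ℝ} (hμ : 0 < μ) : Continuous (cov μ) :=
  continuous_const.div
    (Real.continuous_sin.comp (continuous_freq μ)) fun k => (sin_freq_pos hμ k).ne'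

/-! ### Fourier transform of the amplitudes. -/

lemma hasSum_fourier_shift {x : ℤ → ℂ} {k : ℝ} {g : ℂ} (d : ℤ)
    (h : HasSum (fun j : ℤ => x j * Complex.exp (Complex.I * j * k)) g) :
    HasSum (fun j : ℤ => x (j - d) * Complex.exp (Complex.I * j * k))
      (Complex.exp (Complex.I * d * k) * g) := by
  have h1 := ((Equiv.subRight d).hasSum_iff.2 h).mul_left (Complex.exp (Complex.I * d * k))
  refine h1.congr_fun fun j => ?_
  simp only [Function.comp_apply, Equiv.subRight_apply]
  rw [mul_left_comm, ← Complex.exp_add]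
  congr 2
  push_cast
  ring

/-- The recursion couples the real part for one direction with the imaginary part for the other,
hence the joint induction over both parts and both directions. The closed form propagates by the
angle addition formulas, with `sin_freq_sq` supplying the quadratic relation. -/
lemma hasSum_fourier_pathSum {μ : ℝ} (hμ : 0 < μ) (k : ℝ) (n : ℕ) : ∀ d : Bool,
    HasSum (fun j : ℤ => ((hop μ ^ n * (pathSum μ n d j).re : ℝ) : ℂ)
        * Complex.exp (Complex.I * j * k))
      (Complex.exp (Complex.I * sgn d * k) * (Real.cos (n * freq μ k)
        + Complex.I * sgn d * vel μ k * Real.sin (n * freq μ k))) ∧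
    HasSum (fun j : ℤ => ((hop μ ^ n * (pathSum μ n d j).im : ℝ) : ℂ)
        * Complex.exp (Complex.I * j * k))
      (-(cov μ k * Real.sin (n * freq μ k))) := by
  induction n with
  | zero =>
    intro d
    constructor
    · have h := hasSum_single (f := fun j : ℤ => ((hop μ ^ 0 * (pathSum μ 0 d j).re : ℝ) : ℂ)
        * Complex.exp (Complex.I * j * k)) (sgn d) fun j hj => by simp [pathSum, hj]
      simpa [pathSum] using h
    · convert! hasSum_zero using 1
      · ext j
        rw [pathSum]
        split_ifs <;> simp
      · simp
  | succ n ih =>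
    intro d
    have hs := sin_freq_pos hμ k
    have hs2 := sin_freq_sq hμ k
    have hc := cos_freq hμ k
    have hC : Real.cos ((n + 1 : ℕ) * freq μ k) = Real.cos (n * freq μ k) * (hop μ * Real.cos k)
        - Real.sin (n * freq μ k) * Real.sin (freq μ k) := by
      rw [← hc, ← Real.cos_add]; push_cast; ring_nf
    have hS : Real.sin ((n + 1 : ℕ) * freq μ k) = Real.sin (n * freq μ k) * (hop μ * Real.cos k)
        + Real.cos (n * freq μ k) * Real.sin (freq μ k) := by
      rw [← hc, ← Real.sin_add]; push_cast; ring_nf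
    have hE : Complex.exp (Complex.I * sgn d * k)
        = Real.cos k + Complex.I * sgn d * Real.sin k := by
      cases d
      · rw [show Complex.I * (sgn false : ℤ) * k = ((-k : ℝ) : ℂ) * Complex.I by simp [sgn]; ring,
          Complex.exp_mul_I, ← Complex.ofReal_cos, ← Complex.ofReal_sin]
        simp [sgn]; ring
      · rw [show Complex.I * (sgn true : ℤ) * k = (k : ℂ) * Complex.I by simp [sgn]; ring,
          Complex.exp_mul_I, ← Complex.ofReal_cos, ← Complex.ofReal_sin]
        simp [sgn]; ring
    have hEE : Complex.exp (Complex.I * sgn d * k) * Complex.exp (Complex.I * sgn (!d) * k)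
        = 1 := by
      rw [← Complex.exp_add, Complex.exp_eq_one_iff]
      exact ⟨0, by cases d <;> simp [sgn]⟩
    have hσ : (sgn d : ℂ) ^ 2 = 1 := by cases d <;> simp [sgn]
    have hσ' : (sgn (!d) : ℂ) = -sgn d := by cases d <;> simp [sgn]
    obtain ⟨h1, h2⟩ := ih d
    obtain ⟨h3, h4⟩ := ih !d
    rw [hC, hS, vel, cov]
    rw [vel] at h1 h3
    rw [cov] at h2 h4
    generalize Real.cos (n * freq μ k) = C at *
    generalize Real.sin (n * freq μ k) = S at *
    generalize Real.sin (freq μ k) = s at *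
    have hs' : (s : ℂ) ≠ 0 := by exact_mod_cast hs.ne'
    have hs2' : (s : ℂ) ^ 2 = hop μ ^ 2 * (μ ^ 2 + Real.sin k ^ 2) := by exact_mod_cast hs2
    constructor
    · convert! ((hasSum_fourier_shift (sgn d) h1).add
        ((hasSum_fourier_shift (sgn d) h4).mul_left (μ : ℂ))).mul_left (hop μ : ℂ) using 1
      · ext j
        rw [pathSum_succ_re]
        push_cast
        ring
      · generalize Complex.exp (Complex.I * sgn d * k) = E at *
        generalize (sgn d : ℂ) = σ at *
        push_cast at *
        -- The recursion step with one common factor `E` removed; the remaining `E` is expanded by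
        -- `hE`.
        have : (C * (hop μ * Complex.cos k) - S * s
            + Complex.I * σ * (hop μ * Complex.sin k / s) * (S * (hop μ * Complex.cos k) + C * s) : ℂ)
            = hop μ * (E * (C + Complex.I * σ * (hop μ * Complex.sin k / s) * S)
              - μ * (hop μ * μ / s * S)) := by
          rw [hE]
          field_simp
          linear_combination (-S : ℂ) * hs2'
            - S * hop μ ^ 2 * Complex.sin k ^ 2 * (σ ^ 2 * Complex.I_sq - hσ)
        rw [this]
        ring
    · convert! ((hasSum_fourier_shift (sgn d) h2).sub
        ((hasSum_fourier_shift (sgn d) h3).mul_left (μ : ℂ))).mul_left (hop μ : ℂ) using 1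
      · ext j
        rw [pathSum_succ_im]
        push_cast
        ring
      · rw [hσ']
        rw [hσ'] at hEE
        generalize Complex.exp (Complex.I * sgn d * k) = E at *
        generalize Complex.exp (Complex.I * -(sgn d : ℂ) * k) = E' at *
        generalize (sgn d : ℂ) = σ at *
        push_cast at *
        have : (hop μ * μ / s * (S * (hop μ * Complex.cos k) + C * s) : ℂ)
            = hop μ * (E * (hop μ * μ / s * S)
              + μ * (C - Complex.I * σ * (hop μ * Complex.sin k / s) * S)) := by
          rw [hE]
          field_simp
          ring
        rw [this]
        linear_combination (hop μ * μ * (C - Complex.I * σ * (hop μ * Complex.sin k / s) * S) : ℂ)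
          * hEE

/-! ### Parseval's identity and the characteristic function. -/

/-- The period may start at any `b`; the choice `b = -π/2` is what later makes the change of
variable land on `[0, π]`. -/
lemma integral_exp_int_mul (l : ℤ) (b : ℝ) :
    ∫ k in b..b + 2 * Real.pi, Complex.exp (Complex.I * l * k)
      = if l = 0 then 2 * (Real.pi : ℂ) else 0 := by
  split_ifs with h
  · simp [h]
  · have hl : Complex.I * (l : ℂ) ≠ 0 := by simp [h]
    rw [integral_exp_mul_complex hl, div_eq_zero_iff, sub_eq_zero]
    left
    rw [Complex.exp_eq_exp_iff_exists_int]
    exact ⟨l, by push_cast; ring⟩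

/-- Parseval's identity for the product of a trigonometric polynomial and its translate. -/
lemma sum_sq_mul_exp_eq_integral {x : ℤ → ℝ} {s : Finset ℤ} (hx : ∀ j ∉ s, x j = 0) {g : ℝ → ℂ}
    (hg : ∀ k : ℝ, HasSum (fun j : ℤ => (x j : ℂ) * Complex.exp (Complex.I * j * k)) (g k))
    (h b : ℝ) : ∑ j ∈ s, (x j : ℂ) ^ 2 * Complex.exp (Complex.I * j * h)
      = 1 / (2 * Real.pi) * ∫ k in b..b + 2 * Real.pi, conj (g k) * g (k + h) := by
  have hg' : ∀ k, g k = ∑ j ∈ s, (x j : ℂ) * Complex.exp (Complex.I * j * k) := fun k =>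
    (hg k).unique (hasSum_sum_of_ne_finset_zero fun j hj => by simp [hx j hj])
  have h1 : ∀ k : ℝ, conj (g k) * g (k + h) = ∑ i ∈ s, ∑ j ∈ s,
      (x i * x j * Complex.exp (Complex.I * j * h)) * Complex.exp (Complex.I * (j - i : ℤ) * k) := by
    intro k
    rw [hg', hg', map_sum, Finset.sum_mul_sum]
    refine Finset.sum_congr rfl fun i _ => Finset.sum_congr rfl fun j _ => ?_
    rw [map_mul, Complex.conj_ofReal, ← Complex.exp_conj]
    simp only [map_mul, Complex.conj_I, Complex.conj_ofReal, map_intCast]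
    rw [mul_mul_mul_comm, mul_assoc ((x i : ℂ) * x j), ← Complex.exp_add, ← Complex.exp_add]
    congr 2
    push_cast
    ring
  simp_rw [h1]
  rw [intervalIntegral.integral_finsetSum]
  · have h2 : ∀ i ∈ s, ∫ k in b..b + 2 * Real.pi, ∑ j ∈ s, (x i * x j * Complex.exp
        (Complex.I * j * h)) * Complex.exp (Complex.I * (j - i : ℤ) * k)
        = 2 * Real.pi * ((x i : ℂ) ^ 2 * Complex.exp (Complex.I * i * h)) := by
      intro i hi
      rw [intervalIntegral.integral_finsetSum]
      · simp_rw [intervalIntegral.integral_const_mul, integral_exp_int_mul, sub_eq_zero]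
        simp only [mul_ite, mul_zero, Finset.sum_ite_eq', hi, if_true]
        ring
      · intro j _
        exact Continuous.intervalIntegrable (by fun_prop) _ _
    rw [Finset.sum_congr rfl h2, ← Finset.mul_sum, ← mul_assoc]
    rw [one_div_mul_cancel (by simp [Real.pi_ne_zero]), one_mul]
  · intro i _
    exact Continuous.intervalIntegrable (by fun_prop) _ _

/-- The probability to find the electron at `j` after `n + 1` unit steps. -/
def prob (μ : ℝ) (n : ℕ) (j : ℤ) : ℝ := hop μ ^ (2 * n) * ‖pathSum μ n true j‖ ^ 2

lemma prob_nonneg (μ : ℝ) (n : ℕ) (j : ℤ) : 0 ≤ prob μ n j :=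
  mul_nonneg (pow_nonneg (hop_pos μ).le _) (sq_nonneg _)

lemma prob_eq_zero (μ : ℝ) (n : ℕ) (j : ℤ) (hj : j ∉ Finset.Icc (-(n + 1 : ℤ)) (n + 1)) :
    prob μ n j = 0 := by
  simp [prob, pathSum_eq_zero μ n true j hj]

lemma prob_eq (μ : ℝ) (n : ℕ) (j : ℤ) : prob μ n j
    = (hop μ ^ n * (pathSum μ n true j).re) ^ 2 + (hop μ ^ n * (pathSum μ n true j).im) ^ 2 := by
  rw [prob, ← Complex.normSq_eq_norm_sq, Complex.normSq_apply]
  ring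

/-- The integrand in the Fourier representation of the characteristic function of `prob μ n`. -/
def charKernel (μ : ℝ) (n : ℕ) (h k : ℝ) : ℂ :=
  Complex.exp (Complex.I * h)
    * (Real.cos (n * freq μ k) - Complex.I * vel μ k * Real.sin (n * freq μ k))
    * (Real.cos (n * freq μ (k + h)) + Complex.I * vel μ (k + h) * Real.sin (n * freq μ (k + h)))
  + cov μ k * Real.sin (n * freq μ k) * (cov μ (k + h) * Real.sin (n * freq μ (k + h)))

lemma continuous_charKernel {μ : ℝ} (hμ : 0 < μ) (n : ℕ) (h : ℝ) :
    Continuous (charKernel μ n h) := by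
  have h1 := continuous_freq μ
  have h2 := continuous_vel hμ
  have h3 := continuous_cov hμ
  unfold charKernel
  fun_prop

lemma sum_prob_mul_exp {μ : ℝ} (hμ : 0 < μ) (n : ℕ) (h b : ℝ) :
    ∑ j ∈ Finset.Icc (-(n + 1 : ℤ)) (n + 1), (prob μ n j : ℂ) * Complex.exp (Complex.I * j * h)
      = 1 / (2 * Real.pi) * ∫ k in b..b + 2 * Real.pi, charKernel μ n h k := by
  have h1 := continuous_freq μ
  have h2 := continuous_vel hμ
  have h3 := continuous_cov hμ
  have e1 := sum_sq_mul_exp_eq_integral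
    (x := fun j => hop μ ^ n * (pathSum μ n true j).re) (s := Finset.Icc (-(n + 1 : ℤ)) (n + 1))
    (fun j hj => by simp [pathSum_eq_zero μ n true j hj])
    (fun k => (hasSum_fourier_pathSum hμ k n true).1) h b
  have e2 := sum_sq_mul_exp_eq_integral
    (x := fun j => hop μ ^ n * (pathSum μ n true j).im) (s := Finset.Icc (-(n + 1 : ℤ)) (n + 1))
    (fun j hj => by simp [pathSum_eq_zero μ n true j hj])
    (fun k => (hasSum_fourier_pathSum hμ k n true).2) h b
  calc _ = _ := Finset.sum_congr rfl fun j _ => by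
        rw [prob_eq, Complex.ofReal_add, Complex.ofReal_pow, Complex.ofReal_pow, add_mul]
    _ = _ := by
        rw [Finset.sum_add_distrib, e1, e2, ← mul_add, ← intervalIntegral.integral_add]
        · congr 2
          ext k
          simp only [charKernel, map_mul, map_add, map_neg, ← Complex.exp_conj, Complex.conj_I,
            Complex.conj_ofReal, map_intCast]
          have : Complex.exp (Complex.I * h) = Complex.exp (-Complex.I * (sgn true : ℤ) * k)
              * Complex.exp (Complex.I * (sgn true : ℤ) * (k + h : ℝ)) := by
            rw [← Complex.exp_add]
            congr 1
            simp [sgn]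
            ring
          rw [this]
          simp only [sgn, if_true, Int.cast_one]
          ring
        · exact Continuous.intervalIntegrable (by fun_prop) _ _
        · exact Continuous.intervalIntegrable (by fun_prop) _ _

lemma abs_vel_le_one {μ : ℝ} (hμ : 0 < μ) (k : ℝ) : |vel μ k| ≤ 1 :=
  abs_le_one_iff_mul_self_le_one.2 (by nlinarith [vel_sq_add_cov_sq hμ k, sq_nonneg (cov μ k)])

lemma abs_cov_le_one {μ : ℝ} (hμ : 0 < μ) (k : ℝ) : |cov μ k| ≤ 1 :=
  abs_le_one_iff_mul_self_le_one.2 (by nlinarith [vel_sq_add_cov_sq hμ k, sq_nonneg (vel μ k)])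

/-- At frequency zero the kernel is identically one, by `vel_sq_add_cov_sq`. -/
lemma sum_prob {μ : ℝ} (hμ : 0 < μ) (n : ℕ) :
    ∑ j ∈ Finset.Icc (-(n + 1 : ℤ)) (n + 1), prob μ n j = 1 := by
  have h := sum_prob_mul_exp hμ n 0 0
  have h1 : ∀ k, charKernel μ n 0 k = 1 := by
    intro k
    have e : ((vel μ k : ℂ)) ^ 2 + (cov μ k : ℂ) ^ 2 = 1 := by
      exact_mod_cast vel_sq_add_cov_sq hμ k
    have e' : ((Real.cos (n * freq μ k) : ℂ)) ^ 2 + (Real.sin (n * freq μ k) : ℂ) ^ 2 = 1 := by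
      exact_mod_cast Real.cos_sq_add_sin_sq _
    simp only [charKernel, add_zero, Complex.ofReal_zero, mul_zero, Complex.exp_zero]
    linear_combination (Real.sin (n * freq μ k) : ℂ) ^ 2 * e + e'
      - (vel μ k : ℂ) ^ 2 * (Real.sin (n * freq μ k) : ℂ) ^ 2 * Complex.I_sq
  simp only [h1, Complex.ofReal_zero, mul_zero, Complex.exp_zero, mul_one,
    intervalIntegral.integral_const, zero_add, sub_zero, Complex.real_smul] at h
  have : (Real.pi : ℂ) ≠ 0 := by exact_mod_cast Real.pi_ne_zero
  push_cast at h
  rw [one_div_mul_cancel (by simp [this])] at h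
  exact_mod_cast h

/-! ### Large-time limit of the kernel. -/

lemma norm_cos_add_I_mul_sin_le {v : ℝ} (hv : |v| ≤ 1) (x : ℝ) :
    ‖(Real.cos x + Complex.I * v * Real.sin x : ℂ)‖ ≤ 2 := by
  refine (norm_add_le _ _).trans ?_
  rw [norm_mul, norm_mul, Complex.norm_I, Complex.norm_real, Complex.norm_real, Complex.norm_real,
    Real.norm_eq_abs, Real.norm_eq_abs, Real.norm_eq_abs]
  nlinarith [Real.abs_cos_le_one x, Real.abs_sin_le_one x, abs_nonneg v, abs_nonneg (Real.sin x)]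

lemma norm_cos_sub_I_mul_sin_le {v : ℝ} (hv : |v| ≤ 1) (x : ℝ) :
    ‖(Real.cos x - Complex.I * v * Real.sin x : ℂ)‖ ≤ 2 := by
  have h := norm_cos_add_I_mul_sin_le (v := -v) (by rwa [abs_neg]) x
  convert! h using 2
  push_cast
  ring

lemma norm_exp_I_mul (h : ℝ) : ‖Complex.exp (Complex.I * h)‖ = 1 := by
  rw [mul_comm, Complex.norm_exp_ofReal_mul_I]

/-- A crude bound suffices: it only serves as the dominating constant, uniform in `n`. -/
lemma norm_charKernel_le {μ : ℝ} (hμ : 0 < μ) (n : ℕ) (h k : ℝ) : ‖charKernel μ n h k‖ ≤ 5 := by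
  have h1 := norm_cos_sub_I_mul_sin_le (abs_vel_le_one hμ k) (n * freq μ k)
  have h2 := norm_cos_add_I_mul_sin_le (abs_vel_le_one hμ (k + h)) (n * freq μ (k + h))
  have h3 : ∀ k', ‖(cov μ k' * Real.sin (n * freq μ k') : ℂ)‖ ≤ 1 := fun k' => by
    rw [← Complex.ofReal_mul, Complex.norm_real, Real.norm_eq_abs, abs_mul]
    exact mul_le_one₀ (abs_cov_le_one hμ _) (abs_nonneg _) (Real.abs_sin_le_one _)
  refine (norm_add_le _ _).trans ?_
  rw [norm_mul, norm_mul, norm_exp_I_mul, norm_mul _ (_ * _ : ℂ), one_mul]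
  calc _ ≤ (2 * 2 + 1 * 1 : ℝ) := by
        gcongr
        · exact h3 _
        · exact h3 _
    _ = 5 := by norm_num

/-- The limit of `charKernel`. -/
def limKernel (μ ξ k : ℝ) : ℂ :=
  Real.cos (ξ * vel μ k) + Complex.I * vel μ k * Real.sin (ξ * vel μ k)

/-- The difference quotient with increment `1 / (n + 1)` carries the factor `n + 1` instead of `n`;
the one surplus increment of `freq` tends to zero by continuity. -/
lemma tendsto_freq_shift {μ : ℝ} (hμ : 0 < μ) (ξ k : ℝ) :
    Tendsto (fun n : ℕ => n * freq μ (k + ξ / (n + 1)) - n * freq μ k) atTop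
      (𝓝 (ξ * vel μ k)) := by
  have h0 : Tendsto (fun n : ℕ => 1 / ((n : ℝ) + 1)) atTop (𝓝 0) :=
    tendsto_one_div_add_atTop_nhds_zero_nat
  have h1 : HasDerivAt (fun y => freq μ (k + ξ * y)) (ξ * vel μ k) 0 := by
    have h2 : HasDerivAt (freq μ) (vel μ k) (k + ξ * 0) := by
      simpa using hasDerivAt_freq hμ k
    have h3 := h2.comp (0 : ℝ) (((hasDerivAt_id (0 : ℝ)).const_mul ξ).const_add k)
    simpa [mul_comm, Function.comp_def] using h3
  have h2 := (hasDerivAt_iff_tendsto_slope_zero.1 h1).comp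
    (tendsto_nhdsWithin_iff.2 ⟨h0, Eventually.of_forall fun n => by
      have : (n : ℝ) + 1 ≠ 0 := by positivity
      simp [this]⟩)
  have h3 : Tendsto (fun n : ℕ => freq μ (k + ξ / (n + 1)) - freq μ k) atTop (𝓝 0) := by
    have h4 : Tendsto (fun n : ℕ => freq μ (k + ξ * (1 / ((n : ℝ) + 1))) - freq μ k) atTop
        (𝓝 (freq μ (k + ξ * 0) - freq μ k)) :=
      ((((continuous_freq μ).tendsto _).comp ((h0.const_mul ξ).const_add k))).sub_const _
    simpa [div_eq_mul_inv] using h4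
  have h4 := h2.sub h3
  rw [sub_zero] at h4
  refine h4.congr fun n => ?_
  simp only [Function.comp_apply, zero_add, mul_zero, add_zero, one_div, inv_inv, smul_eq_mul,
    ← div_eq_mul_inv]
  ring

/-- The separate phases oscillate; only their difference converges. Freezing `vel` and `cov` at `k`
and replacing the exponential prefactor by one makes the kernel depend on that difference alone,
through `vel² + cov² = 1` and the subtraction formulas. The three replacement errors vanish by
continuity. -/
lemma tendsto_charKernel {μ : ℝ} (hμ : 0 < μ) (ξ k : ℝ) :
    Tendsto (fun n : ℕ => charKernel μ n (ξ / (n + 1)) k) atTop (𝓝 (limKernel μ ξ k)) := by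
  have h0 : Tendsto (fun n : ℕ => ξ / ((n : ℝ) + 1)) atTop (𝓝 0) := by
    simpa [div_eq_mul_inv] using
      (tendsto_one_div_add_atTop_nhds_zero_nat (𝕜 := ℝ)).const_mul ξ
  have hmain : Tendsto (fun n : ℕ =>
      (Real.cos (n * freq μ (k + ξ / (n + 1)) - n * freq μ k) + Complex.I * vel μ k
        * Real.sin (n * freq μ (k + ξ / (n + 1)) - n * freq μ k) : ℂ)) atTop
      (𝓝 (limKernel μ ξ k)) := by
    have hc : Continuous fun y : ℝ =>
        (Real.cos y + Complex.I * vel μ k * Real.sin y : ℂ) := by fun_prop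
    exact (hc.tendsto _).comp (tendsto_freq_shift hμ ξ k)
  have herr : Tendsto (fun n : ℕ => ‖Complex.exp (Complex.I * (ξ / (n + 1) : ℝ)) - 1‖ * (2 * 2)
      + 2 * |vel μ (k + ξ / (n + 1)) - vel μ k| + |cov μ (k + ξ / (n + 1)) - cov μ k|)
      atTop (𝓝 0) := by
    have hv := continuous_vel hμ
    have hq := continuous_cov hμ
    have hc : Continuous fun h : ℝ => ‖Complex.exp (Complex.I * h) - 1‖ * (2 * 2)
        + 2 * |vel μ (k + h) - vel μ k| + |cov μ (k + h) - cov μ k| := by fun_prop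
    simpa [Function.comp_def] using (hc.tendsto 0).comp h0
  rw [tendsto_iff_norm_sub_tendsto_zero] at hmain ⊢
  refine squeeze_zero (fun _ => norm_nonneg _) (fun n => ?_) (add_zero (0 : ℝ) ▸ herr.add hmain)
  refine (norm_sub_le_norm_sub_add_norm_sub _ _ _).trans (add_le_add_left ?_ _)
  generalize ξ / ((n : ℝ) + 1) = h
  have hq := abs_cov_le_one hμ k
  have h1 := norm_cos_sub_I_mul_sin_le (abs_vel_le_one hμ k) (n * freq μ k)
  have h2 := norm_cos_add_I_mul_sin_le (abs_vel_le_one hμ k) (n * freq μ (k + h))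
  have e : (vel μ k : ℂ) ^ 2 + (cov μ k : ℂ) ^ 2 = 1 := by
    exact_mod_cast vel_sq_add_cov_sq hμ k
  -- One summand per replacement: the exponential, then `vel`, then `cov`.
  have key : charKernel μ n h k - (Real.cos (n * freq μ (k + h) - n * freq μ k)
      + Complex.I * vel μ k * Real.sin (n * freq μ (k + h) - n * freq μ k))
      = (Complex.exp (Complex.I * h) - 1)
          * ((Real.cos (n * freq μ k) - Complex.I * vel μ k * Real.sin (n * freq μ k))
          * (Real.cos (n * freq μ (k + h)) + Complex.I * vel μ k * Real.sin (n * freq μ (k + h))))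
        + Complex.exp (Complex.I * h)
          * (Real.cos (n * freq μ k) - Complex.I * vel μ k * Real.sin (n * freq μ k))
          * (Complex.I * (vel μ (k + h) - vel μ k : ℝ) * Real.sin (n * freq μ (k + h)))
        + cov μ k * Real.sin (n * freq μ k)
          * ((cov μ (k + h) - cov μ k : ℝ) * Real.sin (n * freq μ (k + h))) := by
    rw [charKernel, Real.cos_sub, Real.sin_sub]
    push_cast
    linear_combination (Complex.sin (n * freq μ k) * Complex.sin (n * freq μ (k + h))) * e
      - vel μ k ^ 2 * Complex.sin (n * freq μ k) * Complex.sin (n * freq μ (k + h)) * Complex.I_sq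
  rw [key]
  refine (norm_add_le _ _).trans (add_le_add ((norm_add_le _ _).trans (add_le_add ?_ ?_)) ?_)
  · rw [norm_mul, norm_mul (_ - _ : ℂ)]
    gcongr
  · rw [norm_mul, norm_mul, norm_exp_I_mul, one_mul, norm_mul, norm_mul, Complex.norm_I, one_mul,
      Complex.norm_real, Complex.norm_real, Real.norm_eq_abs, Real.norm_eq_abs]
    gcongr
    exact mul_le_of_le_one_right (abs_nonneg _) (Real.abs_sin_le_one _)
  · rw [← Complex.ofReal_mul, ← Complex.ofReal_mul, ← Complex.ofReal_mul, Complex.norm_real,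
      Real.norm_eq_abs, abs_mul, abs_mul, abs_mul]
    have a1 := mul_le_one₀ hq (abs_nonneg _) (Real.abs_sin_le_one (n * freq μ k))
    have a2 : |cov μ (k + h) - cov μ k| * |Real.sin (n * freq μ (k + h))| ≤ _ :=
      mul_le_of_le_one_right (abs_nonneg _) (Real.abs_sin_le_one _)
    exact (mul_le_of_le_one_left (by positivity) a1).trans a2

lemma tendsto_integral_charKernel {μ : ℝ} (hμ : 0 < μ) (ξ x y : ℝ) :
    Tendsto (fun n : ℕ => ∫ k in x..y, charKernel μ n (ξ / (n + 1)) k) atTop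
      (𝓝 (∫ k in x..y, limKernel μ ξ k)) :=
  intervalIntegral.tendsto_integral_filter_of_dominated_convergence (fun _ => 5)
    (Eventually.of_forall fun n => (continuous_charKernel hμ n _).aestronglyMeasurable)
    (Eventually.of_forall fun n => Eventually.of_forall fun k _ => norm_charKernel_le hμ n _ k)
    (by simp) (Eventually.of_forall fun k _ => tendsto_charKernel hμ ξ k)

/-! ### From characteristic functions to uniform convergence. -/

/-- Pólya's theorem: pointwise convergence of distribution functions to a continuous one is
uniform. -/
lemma tendstoUniformly_of_monotone {ι : Type*} {l : Filter ι} {f : ι → ℝ → ℝ} {g : ℝ → ℝ}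
    (hf : ∀ i, Monotone (f i)) (hf0 : ∀ i x, 0 ≤ f i x) (hf1 : ∀ i x, f i x ≤ 1)
    (hg : Continuous g) (hgm : Monotone g) (hg0 : Tendsto g atBot (𝓝 0))
    (hg1 : Tendsto g atTop (𝓝 1)) (h : ∀ x, Tendsto (fun i => f i x) l (𝓝 (g x))) :
    TendstoUniformly f g l := by
  have hev : ∀ x e, 0 < e → ∀ᶠ i in l, |f i x - g x| < e := fun x e he => by
    simpa [Real.dist_eq] using (Metric.tendsto_nhds.1 (h x)) e he
  have hg0' : ∀ x, 0 ≤ g x := fun x => hgm.le_of_tendsto hg0 x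
  have hg1' : ∀ x, g x ≤ 1 := fun x => hgm.ge_of_tendsto hg1 x
  have hloc : TendstoLocallyUniformly f g l := by
    rw [Metric.tendstoLocallyUniformly_iff]
    intro e he x
    obtain ⟨a, b, hx, hab⟩ := mem_nhds_iff_exists_Ioo_subset.1
      (hg.continuousAt.preimage_mem_nhds (Metric.ball_mem_nhds (g x) (by positivity : 0 < e / 4)))
    obtain ⟨y, hay, hyx⟩ := exists_between hx.1
    obtain ⟨z, hxz, hzb⟩ := exists_between hx.2
    refine ⟨Set.Ioo y z, Ioo_mem_nhds hyx hxz, ?_⟩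
    have hy : y ∈ Set.Ioo a b := ⟨hay, hyx.trans hx.2⟩
    have hz : z ∈ Set.Ioo a b := ⟨hx.1.trans hxz, hzb⟩
    have hy' := abs_lt.1 (by simpa [Real.dist_eq] using hab hy : |g y - g x| < e / 4)
    -- Monotonicity traps both functions on `(y, z)` between their values at `y` and `z`, where `g`
    -- is within `e / 4` of `g x`.
    have hz' := abs_lt.1 (by simpa [Real.dist_eq] using hab hz : |g z - g x| < e / 4)
    filter_upwards [hev y (e / 4) (by positivity), hev z (e / 4) (by positivity)] with i h1 h2
    intro u hu
    rw [abs_lt] at h1 h2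
    have a1 := hf i hu.1.le
    have a2 := hf i hu.2.le
    have a3 := hgm hu.1.le
    have a4 := hgm hu.2.le
    rw [Real.dist_eq, abs_lt]
    constructor <;> linarith [h1.1, h2.2, hy'.1, hz'.2]
  rw [Metric.tendstoUniformly_iff]
  intro e he
  -- Compactness handles `[A, B]`; on the tails, closeness at `A` or `B` together with monotonicity
  -- and the bounds `0` and `1` is enough.
  obtain ⟨A, hA⟩ := (hg0.eventually_lt_const (by positivity : 0 < e / 2)).exists
  obtain ⟨B, hB⟩ := (hg1.eventually_const_lt (by linarith : 1 - e / 2 < 1)).exists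
  have hK := (tendstoLocallyUniformlyOn_iff_tendstoUniformlyOn_of_compact
    (isCompact_Icc (a := A) (b := B))).1 hloc.tendstoLocallyUniformlyOn
  filter_upwards [Metric.tendstoUniformlyOn_iff.1 hK e he, hev A (e / 2) (by positivity),
    hev B (e / 2) (by positivity)] with i h1 h2 h3
  intro x
  rw [abs_lt] at h2 h3
  rcases lt_or_ge x A with hx | hx
  · rw [Real.dist_eq, abs_lt]
    constructor <;> linarith [hf i hx.le, hgm hx.le, hf0 i x, hg0' x]
  rcases lt_or_ge B x with hx' | hx'
  · rw [Real.dist_eq, abs_lt]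
    constructor <;> linarith [hf i hx'.le, hgm hx'.le, hf1 i x, hg1' x]
  exact h1 x ⟨hx, hx'⟩

/-- The jump at a point is the mass of that point. -/
lemma continuous_cdf (μ : Measure ℝ) [IsProbabilityMeasure μ] [NullSingletonClass μ] :
    Continuous (cdf μ) := by
  rw [continuous_iff_continuousAt]
  intro x
  rw [(monotone_cdf μ).continuousAt_iff_leftLim_eq_rightLim, (cdf μ).rightLim_eq]
  have h : (cdf μ).measure {x} = 0 := by rw [measure_cdf, measure_singleton]
  rw [StieltjesFunction.measure_singleton, ENNReal.ofReal_eq_zero] at h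
  exact le_antisymm ((monotone_cdf μ).leftLim_le le_rfl) (by linarith)

/-- Convergence of characteristic functions to that of an atomless law implies uniform convergence
of the distribution functions. -/
lemma tendstoUniformly_cdf {μ : ℕ → Measure ℝ} [∀ n, IsProbabilityMeasure (μ n)]
    {ν : Measure ℝ} [IsProbabilityMeasure ν] [NullSingletonClass ν]
    (h : ∀ ξ, Tendsto (fun n => charFun (μ n) ξ) atTop (𝓝 (charFun ν ξ))) :
    TendstoUniformly (fun n => cdf (μ n)) (cdf ν) atTop := by
  refine tendstoUniformly_of_monotone (fun n => monotone_cdf _) (fun n => cdf_nonneg _)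
    (fun n => cdf_le_one _) (continuous_cdf ν) (monotone_cdf ν) (tendsto_cdf_atBot ν)
    (tendsto_cdf_atTop ν) fun x => ?_
  let μ' : ℕ → ProbabilityMeasure ℝ := fun n => ⟨μ n, inferInstance⟩
  let ν' : ProbabilityMeasure ℝ := ⟨ν, inferInstance⟩
  -- Lévy's continuity theorem, followed by the portmanteau theorem on a half-line whose boundary
  -- point is null.
  have h1 : Tendsto μ' atTop (𝓝 ν') := ProbabilityMeasure.tendsto_iff_tendsto_charFun.2 h
  have h2 := ProbabilityMeasure.tendsto_measure_of_null_frontier_of_tendsto' h1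
    (E := Set.Iic x)
    (by rw [frontier_Iic]; exact measure_singleton (μ := ν) x)
  simp_rw [cdf_eq_real, measureReal_def]
  exact (ENNReal.tendsto_toReal (measure_ne_top _ _)).comp h2

/-! ### The limit law as the image of a uniform angle. -/

/-- The limiting velocity as a function of a uniformly distributed angle. -/
def angleVel (μ θ : ℝ) : ℝ := hop μ * (hop μ - Real.cos θ) / (1 - hop μ * Real.cos θ)

lemma angleVel_denom_pos {μ : ℝ} (hμ : 0 < μ) (θ : ℝ) : 0 < 1 - hop μ * Real.cos θ := by
  linarith [(abs_lt.1 (abs_hop_mul_cos_lt hμ θ)).2]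

lemma continuous_angleVel {μ : ℝ} (hμ : 0 < μ) : Continuous (angleVel μ) :=
  (by fun_prop : Continuous fun θ => hop μ * (hop μ - Real.cos θ)).div
    (by fun_prop) fun θ => (angleVel_denom_pos hμ θ).ne'

/-- This identifies `k + freq μ k` as the angle that is uniformly distributed in the limit. -/
lemma angleVel_add_freq {μ : ℝ} (hμ : 0 < μ) (k : ℝ) : angleVel μ (k + freq μ k) = vel μ k := by
  have h1 := angleVel_denom_pos hμ (k + freq μ k)
  have h2 := sin_freq_pos hμ k
  have h3 := Real.sin_sq_add_cos_sq (freq μ k)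
  have h4 := Real.sin_sq_add_cos_sq k
  rw [angleVel, vel, div_eq_div_iff h1.ne' h2.ne', Real.cos_add, cos_freq hμ]
  rw [cos_freq hμ] at h3
  linear_combination (hop μ * Real.sin k) * h3 - hop μ ^ 2 * Real.sin (freq μ k) * h4

lemma freq_neg (μ k : ℝ) : freq μ (-k) = freq μ k := by simp [freq]

lemma vel_neg (μ k : ℝ) : vel μ (-k) = -vel μ k := by
  simp [vel, freq_neg, neg_div]

lemma vel_add_pi (μ k : ℝ) : vel μ (k + Real.pi) = -vel μ k := by
  have h : freq μ (k + Real.pi) = Real.pi - freq μ k := by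
    simp [freq, Real.arccos_neg]
  simp [vel, h, neg_div]

lemma limKernel_add_pi (μ ξ k : ℝ) : limKernel μ ξ (k + Real.pi) = limKernel μ ξ k := by
  simp [limKernel, vel_add_pi]

lemma intervalIntegral_odd {f : ℝ → ℂ} (hf : ∀ x, f (-x) = -f x) (b : ℝ) :
    ∫ x in -b..b, f x = 0 := by
  have h := intervalIntegral.integral_comp_neg (a := -b) (b := b) f
  simp only [hf, intervalIntegral.integral_neg, neg_neg] at h
  exact self_eq_neg.1 h.symm

/-- The kernel has period `π`, so half the interval is integrated twice. There it differs from `(1 +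
vel) * exp (i ξ vel)` by a function that is odd in `k`, because `vel` is odd. Since `freq μ (±π/2) =
π/2`, the substitution `θ = k + freq μ k` carries `[-π/2, π/2]` to `[0, π]`. -/
lemma integral_limKernel {μ : ℝ} (hμ : 0 < μ) (ξ : ℝ) :
    ∫ k in -(Real.pi / 2)..-(Real.pi / 2) + 2 * Real.pi, limKernel μ ξ k
      = 2 * ∫ θ in 0..Real.pi, Complex.exp (ξ * angleVel μ θ * Complex.I) := by
  have hv := continuous_vel hμ
  have hV := continuous_angleVel hμ
  have hcont : Continuous (limKernel μ ξ) := by unfold limKernel; fun_prop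
  have h1 : ∫ k in -(Real.pi / 2)..-(Real.pi / 2) + 2 * Real.pi, limKernel μ ξ k
      = 2 * ∫ k in -(Real.pi / 2)..Real.pi / 2, limKernel μ ξ k := by
    rw [← intervalIntegral.integral_add_adjacent_intervals (b := Real.pi / 2)
      (hcont.intervalIntegrable _ _) (hcont.intervalIntegrable _ _)]
    have h := intervalIntegral.integral_comp_add_right (a := -(Real.pi / 2)) (b := Real.pi / 2)
      (limKernel μ ξ) Real.pi
    simp only [limKernel_add_pi] at h
    rw [show -(Real.pi / 2) + Real.pi = Real.pi / 2 by ring,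
      show Real.pi / 2 + Real.pi = -(Real.pi / 2) + 2 * Real.pi by ring] at h
    rw [← h, two_mul]
  have h2 : ∫ k in -(Real.pi / 2)..Real.pi / 2, limKernel μ ξ k
      = ∫ k in -(Real.pi / 2)..Real.pi / 2,
        (1 + vel μ k) • Complex.exp (ξ * vel μ k * Complex.I) := by
    rw [← sub_eq_zero, ← intervalIntegral.integral_sub (hcont.intervalIntegrable _ _)
      (Continuous.intervalIntegrable (by fun_prop) _ _)]
    apply intervalIntegral_odd
    intro k
    have e : ∀ y : ℝ, Complex.exp (ξ * y * Complex.I)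
        = Real.cos (ξ * y) + Real.sin (ξ * y) * Complex.I := fun y => by
      rw [← Complex.ofReal_mul, Complex.exp_mul_I, Complex.ofReal_cos, Complex.ofReal_sin]
    simp only [limKernel, e, vel_neg, Complex.real_smul, mul_neg, Real.cos_neg, Real.sin_neg]
    push_cast
    ring
  have h3 := intervalIntegral.integral_deriv_smul_comp (a := -(Real.pi / 2)) (b := Real.pi / 2)
    (f := fun k => k + freq μ k) (f' := fun k => 1 + vel μ k)
    (g := fun θ => Complex.exp (ξ * angleVel μ θ * Complex.I))
    (fun k _ => (hasDerivAt_id k).add (hasDerivAt_freq hμ k)) (by fun_prop) (by fun_prop)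
  simp only [Function.comp_apply, angleVel_add_freq hμ] at h3
  rw [h1, h2, h3]
  simp [freq]

/-- The law of `angleVel μ θ` for `θ` uniform in `[0, π]`. -/
def limLaw (μ : ℝ) : Measure ℝ :=
  ENNReal.ofReal (1 / Real.pi) • (volume.restrict (Set.Icc 0 Real.pi)).map (angleVel μ)

lemma limLaw_apply {μ : ℝ} (hμ : 0 < μ) {s : Set ℝ} (hs : MeasurableSet s) :
    limLaw μ s = ENNReal.ofReal (1 / Real.pi)
      * volume (angleVel μ ⁻¹' s ∩ Set.Icc 0 Real.pi) := by
  have hm := (continuous_angleVel hμ).measurable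
  rw [limLaw, Measure.smul_apply, Measure.map_apply hm hs, Measure.restrict_apply (hm hs),
    smul_eq_mul]

lemma isProbabilityMeasure_limLaw {μ : ℝ} (hμ : 0 < μ) : IsProbabilityMeasure (limLaw μ) := by
  constructor
  rw [limLaw_apply hμ MeasurableSet.univ, Set.preimage_univ, Set.univ_inter, Real.volume_Icc,
    sub_zero, ← ENNReal.ofReal_mul (by positivity), one_div_mul_cancel Real.pi_ne_zero,
    ENNReal.ofReal_one]

/-- `angleVel` is a nondegenerate Möbius function of `cos θ`, hence injective on `[0, π]`, so every
fibre there has at most one point. -/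
lemma nullSingletonClass_limLaw {μ : ℝ} (hμ : 0 < μ) : NullSingletonClass (limLaw μ) := by
  constructor
  intro x
  rw [limLaw_apply hμ (measurableSet_singleton x), Set.Subsingleton.measure_zero, mul_zero]
  rintro θ ⟨h1, hθ⟩ θ' ⟨h2, hθ'⟩
  refine Real.injOn_cos hθ hθ' ?_
  have h3 : angleVel μ θ = angleVel μ θ' := (Set.mem_singleton_iff.1 h1).trans h2.symm
  rw [angleVel, angleVel, div_eq_div_iff (angleVel_denom_pos hμ _).ne'
    (angleVel_denom_pos hμ _).ne'] at h3
  have hc := hop_pos μ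
  have hc1 := hop_lt_one hμ
  have h4 : hop μ * (1 - hop μ ^ 2) * (Real.cos θ - Real.cos θ') = 0 := by
    linear_combination -h3
  have h5 : hop μ * (1 - hop μ ^ 2) ≠ 0 := by
    have : 0 < hop μ * (1 - hop μ ^ 2) := mul_pos hc (by nlinarith)
    exact this.ne'
  exact sub_eq_zero.1 ((mul_eq_zero.1 h4).resolve_left h5)

lemma charFun_limLaw {μ : ℝ} (hμ : 0 < μ) (ξ : ℝ) : charFun (limLaw μ) ξ
    = 1 / Real.pi * ∫ θ in 0..Real.pi, Complex.exp (ξ * angleVel μ θ * Complex.I) := by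
  rw [charFun_apply_real, limLaw, integral_smul_measure,
    integral_map (continuous_angleVel hμ).aemeasurable
      (Continuous.aestronglyMeasurable (by fun_prop)), integral_Icc_eq_integral_Ioc,
    ← intervalIntegral.integral_of_le Real.pi_pos.le, ENNReal.toReal_ofReal (by positivity),
    Complex.real_smul]
  push_cast
  rfl

lemma angleVel_le_iff {μ : ℝ} (hμ : 0 < μ) {v : ℝ} (hv : v < 1) (θ : ℝ) :
    angleVel μ θ ≤ v ↔ (hop μ ^ 2 - v) / (hop μ * (1 - v)) ≤ Real.cos θ := by
  rw [angleVel, div_le_iff₀ (angleVel_denom_pos hμ θ),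
    div_le_iff₀ (mul_pos (hop_pos μ) (by linarith))]
  constructor <;> intro h <;> linarith

lemma abs_angleVel_le {μ : ℝ} (hμ : 0 < μ) (θ : ℝ) : |angleVel μ θ| ≤ hop μ := by
  have h := angleVel_denom_pos hμ θ
  have h1 := hop_pos μ
  have h2 := hop_lt_one hμ
  have h3 := Real.cos_le_one θ
  have h4 := Real.neg_one_le_cos θ
  rw [angleVel, abs_le, le_div_iff₀ h, div_le_iff₀ h]
  constructor
  · nlinarith [mul_nonneg h1.le (mul_nonneg (sub_nonneg.2 h3) (by linarith : 0 ≤ 1 + hop μ))]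
  · nlinarith [mul_nonneg h1.le (mul_nonneg (by linarith : 0 ≤ Real.cos θ + 1)
      (sub_nonneg.2 h2.le))]

/-- The distribution function of `limLaw`. -/
lemma cdf_limLaw {μ : ℝ} (hμ : 0 < μ) [IsProbabilityMeasure (limLaw μ)] (v : ℝ) :
    cdf (limLaw μ) v = if v ≤ -hop μ then 0 else if v < hop μ then
      1 / Real.pi * Real.arccos ((hop μ ^ 2 - v) / (hop μ * (1 - v))) else 1 := by
  have := nullSingletonClass_limLaw hμ
  have h1 := hop_pos μ
  have h2 := hop_lt_one hμ
  rw [cdf_eq_real, measureReal_def]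
  split_ifs with hv hv'
  · rw [ENNReal.toReal_eq_zero_iff]
    left
    refine measure_mono_null (t := Set.Iic (-hop μ)) (Set.Iic_subset_Iic.2 hv) ?_
    -- The value `-hop μ` is attained at `θ = 0`, so the endpoint must first be discarded as a null
    -- set.
    rw [measure_congr Iio_ae_eq_Iic.symm, limLaw_apply hμ measurableSet_Iio]
    have : angleVel μ ⁻¹' Set.Iio (-hop μ) = ∅ := by
      ext θ
      simpa using (abs_le.1 (abs_angleVel_le hμ θ)).1
    simp [this]
  · push Not at hv
    have h3 : angleVel μ ⁻¹' Set.Iic v ∩ Set.Icc 0 Real.pi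
        = Set.Icc 0 (Real.arccos ((hop μ ^ 2 - v) / (hop μ * (1 - v)))) := by
      have h4 : 0 < hop μ * (1 - v) := mul_pos h1 (by linarith)
      have h5 : (hop μ ^ 2 - v) / (hop μ * (1 - v)) ≤ 1 := by
        rw [div_le_one h4]; nlinarith
      have h6 : -1 ≤ (hop μ ^ 2 - v) / (hop μ * (1 - v)) := by
        rw [le_div_iff₀ h4]; nlinarith
      ext θ
      simp only [Set.mem_inter_iff, Set.mem_preimage, Set.mem_Iic, Set.mem_Icc,
        angleVel_le_iff hμ (hv'.trans h2)]
      constructor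
      · rintro ⟨a, b, c⟩
        refine ⟨b, ?_⟩
        rw [← Real.arccos_cos b c]
        exact Real.arccos_le_arccos a
      · rintro ⟨a, b⟩
        refine ⟨?_, a, b.trans (Real.arccos_le_pi _)⟩
        rw [← Real.cos_arccos h6 h5]
        exact Real.cos_le_cos_of_nonneg_of_le_pi a (Real.arccos_le_pi _) b
    rw [limLaw_apply hμ measurableSet_Iic, h3, Real.volume_Icc, sub_zero, ENNReal.toReal_mul,
      ENNReal.toReal_ofReal (by positivity), ENNReal.toReal_ofReal (Real.arccos_nonneg _)]
  · push Not at hv'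
    have : angleVel μ ⁻¹' Set.Iic v = Set.univ := by
      ext θ
      simpa using (abs_le.1 (abs_angleVel_le hμ θ)).2.trans hv'
    rw [limLaw_apply hμ measurableSet_Iic, this, ← Set.preimage_univ (f := angleVel μ),
      ← limLaw_apply hμ MeasurableSet.univ, measure_univ, ENNReal.toReal_one]

/-! ### The law of the mean velocity and the conclusion. -/

/-- The law of the mean velocity `j / (n + 1)` of the electron after `n + 1` unit steps. -/
def velLaw (μ : ℝ) (n : ℕ) : Measure ℝ :=
  ∑ j ∈ Finset.Icc (-(n + 1 : ℤ)) (n + 1),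
    ENNReal.ofReal (prob μ n j) • Measure.dirac ((j : ℝ) / (n + 1))

lemma velLaw_apply (μ : ℝ) (n : ℕ) {s : Set ℝ} (hs : MeasurableSet s) :
    velLaw μ n s = ENNReal.ofReal (∑ j ∈ Finset.Icc (-(n + 1 : ℤ)) (n + 1),
      s.indicator (fun _ => prob μ n j) ((j : ℝ) / (n + 1))) := by
  rw [ENNReal.ofReal_sum_of_nonneg
    fun j _ => Set.indicator_nonneg (fun _ _ => prob_nonneg μ n j) _, velLaw,
    Measure.finsetSum_apply]
  refine Finset.sum_congr rfl fun j _ => ?_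
  rw [Measure.smul_apply, Measure.dirac_apply' _ hs, smul_eq_mul]
  by_cases h : (j : ℝ) / (n + 1) ∈ s <;> simp [h]

lemma isProbabilityMeasure_velLaw {μ : ℝ} (hμ : 0 < μ) (n : ℕ) :
    IsProbabilityMeasure (velLaw μ n) := by
  constructor
  rw [velLaw_apply μ n MeasurableSet.univ]
  simp only [Set.indicator_univ, sum_prob hμ, ENNReal.ofReal_one]

lemma charFun_velLaw (μ : ℝ) (n : ℕ) (ξ : ℝ) : charFun (velLaw μ n) ξ
    = ∑ j ∈ Finset.Icc (-(n + 1 : ℤ)) (n + 1),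
      (prob μ n j : ℂ) * Complex.exp (Complex.I * j * (ξ / (n + 1) : ℝ)) := by
  rw [charFun_apply_real, velLaw, integral_finsetSum_measure]
  · refine Finset.sum_congr rfl fun j _ => ?_
    rw [integral_smul_measure, integral_dirac, ENNReal.toReal_ofReal (prob_nonneg μ n j),
      Complex.real_smul]
    congr 2
    push_cast
    ring
  · intro j _
    exact (integrable_dirac (by simp)).smul_measure ENNReal.ofReal_ne_top

lemma tendsto_charFun_velLaw {μ : ℝ} (hμ : 0 < μ) (ξ : ℝ) :
    Tendsto (fun n => charFun (velLaw μ n) ξ) atTop (𝓝 (charFun (limLaw μ) ξ)) := by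
  have h := (tendsto_integral_charKernel hμ ξ (-(Real.pi / 2))
    (-(Real.pi / 2) + 2 * Real.pi)).const_mul (1 / (2 * Real.pi) : ℂ)
  simp only [← sum_prob_mul_exp hμ, integral_limKernel hμ] at h
  rw [charFun_limLaw hμ]
  simp only [charFun_velLaw]
  convert! h using 2
  ring

lemma distrib_eq_cdf {m ε : ℝ} (hε : 0 < ε) (n : ℕ)
    [IsProbabilityMeasure (velLaw (m * ε) n)] (v : ℝ) :
    distrib v ((n + 1) * ε) m ε = cdf (velLaw (m * ε) n) v := by
  have hn : (0 : ℝ) < n + 1 := by positivity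
  have hP : ∀ j : ℤ, P (j * ε) ((n + 1) * ε) m ε = prob (m * ε) n j := fun j => P_eq hε m n j
  rw [cdf_eq_real, measureReal_def, velLaw_apply _ _ measurableSet_Iic, ENNReal.toReal_ofReal
    (Finset.sum_nonneg fun j _ => Set.indicator_nonneg (fun _ _ => prob_nonneg _ n j) _)]
  have hsub := tsum_subtype {x : ℝ | x ∈ lattice ε ∧ x ≤ v * ((n + 1) * ε)}
    fun x => P x ((n + 1) * ε) m ε
  refine hsub.trans ?_
  rw [tsum_eq_sum
      (s := (Finset.Icc (-(n + 1 : ℤ)) (n + 1)).image fun j : ℤ => (j : ℝ) * ε),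
    Finset.sum_image]
  · refine Finset.sum_congr rfl fun j _ => ?_
    have h : ((j : ℝ) * ε ∈ {x : ℝ | x ∈ lattice ε ∧ x ≤ v * ((n + 1) * ε)})
        ↔ (j : ℝ) / (n + 1) ∈ Set.Iic v := by
      rw [Set.mem_ofPred_eq, and_iff_right ⟨j, rfl⟩, Set.mem_Iic, div_le_iff₀ hn, ← mul_assoc,
        mul_le_mul_iff_left₀ hε]
    by_cases hj : (j : ℝ) / (n + 1) ∈ Set.Iic v
    · rw [Set.indicator_of_mem hj, Set.indicator_of_mem (h.2 hj), hP]
    · rw [Set.indicator_of_notMem hj, Set.indicator_of_notMem (mt h.1 hj)]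
  · intro i _ j _ hij
    exact_mod_cast mul_right_cancel₀ hε.ne' hij
  · intro x hx
    rw [Set.indicator_apply_eq_zero]
    rintro ⟨⟨j, rfl⟩, -⟩
    rw [hP]
    exact prob_eq_zero _ _ _ fun hj => hx (Finset.mem_image_of_mem _ hj)

/-- Both thresholds are `±hop (m * ε)`, and the two arccosine arguments agree after multiplying
numerator and denominator by `1 + (m * ε) ^ 2`. -/
lemma F_eq_cdf {m ε : ℝ} (hm : 0 < m) (hε : 0 < ε) [IsProbabilityMeasure (limLaw (m * ε))]
    (v : ℝ) : F v m ε = cdf (limLaw (m * ε)) v := by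
  have h0 : 0 < √(1 + (m * ε) ^ 2) := by positivity
  have h1 : √(1 + (m * ε) ^ 2) ^ 2 = 1 + (m * ε) ^ 2 := Real.sq_sqrt (by positivity)
  have hc := hop_lt_one (mul_pos hm hε)
  rw [cdf_limLaw (mul_pos hm hε), F, ← mul_pow]
  change (if v ≤ -hop (m * ε) then (0 : ℝ) else if v < hop (m * ε) then _ else 1) = _
  split_ifs with hv hv'
  · rfl
  · have hv1 : 1 - v ≠ 0 := by linarith
    congr 2
    rw [hop]
    generalize √(1 + (m * ε) ^ 2) = r at *
    rw [← h1]
    field_simp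
  · rfl

lemma tendstoUniformly_distrib {m ε : ℝ} (hm : 0 < m) (hε : 0 < ε) :
    TendstoUniformly (fun (n : ℕ) v => distrib v ((n + 1) * ε) m ε) (fun v => F v m ε) atTop := by
  have hμ := mul_pos hm hε
  have := isProbabilityMeasure_velLaw hμ
  have := isProbabilityMeasure_limLaw hμ
  have := nullSingletonClass_limLaw hμ
  simp only [distrib_eq_cdf hε, F_eq_cdf hm hε]
  exact tendstoUniformly_cdf fun ξ => tendsto_charFun_velLaw hμ ξ

end FeynmanCheckers

end

theorem mainTheorem6 (m ε : ℝ) (hm : 0 < m) (hε : 0 < ε) (hεm : ε ≤ 1 / m) :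
    TendstoUniformly (fun t v : ℝ => FeynmanCheckers.distrib v t m ε)
      (fun v : ℝ => FeynmanCheckers.F v m ε) (atTop ⊓ 𝓟 (FeynmanCheckers.lattice ε)) := by
  intro u hu
  -- A lattice time `t = (n + 1) * ε` has index `n = ⌊t / ε⌋₊ - 1`; restricting to `t > 0` makes the
  -- truncated subtraction exact.
  have h := (tendsto_sub_atTop_nat 1).comp
    (tendsto_nat_floor_atTop.comp (tendsto_id.atTop_div_const hε))
  rw [eventually_inf_principal]
  filter_upwards [h.eventually (FeynmanCheckers.tendstoUniformly_distrib hm hε u hu),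
    eventually_gt_atTop 0] with t ht ht0
  rintro ⟨k, rfl⟩ v
  have hk : 0 < k := by exact_mod_cast pos_of_mul_pos_left ht0 hε.le
  obtain ⟨n, rfl⟩ : ∃ n : ℕ, k = n + 1 := ⟨(k - 1).toNat, by omega⟩
  have hn : ⌊((n + 1 : ℤ) : ℝ) * ε / ε⌋₊ - 1 = n := by
    rw [mul_div_cancel_right₀ _ hε.ne']
    have : (((n + 1 : ℤ) : ℝ)) = ((n + 1 : ℕ) : ℝ) := by push_cast; ring
    rw [this, Nat.floor_natCast, Nat.add_sub_cancel]
  have h2 := ht v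
  simp only [Function.comp_apply, id_eq, hn] at h2
  simpa using h2
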